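/- Let $R$ be a left artinian ring; modules are left $R$-modules. The syzygy $\Omega(M)$ of a module $M$ is the kernel of a projective cover of $M$ (unique up to isomorphism), and $\Omega^0(M)=M$, $\Omega^{k}(M)=\Omega(\Omega^{k-1}(M))$ for $k\ge 1$. A module $N$ is periodic if $\Omega^{q}(N)\cong N$ for some $q>0$, and its period is the smallest such $q$. A module $M$ is $(n,p)$-eventually periodic if $n\ge 0$ is the smallest integer such that $\Omega^n(M)$ is periodic, and $p$ is the period of $\Omega^n(M)$. A module is Gorenstein projective if it is isomorphic to $\operatorname{Coker}(T_1\to T_0)$ for some exact complex $T_\bullet=(\cdots\to T_1\to T_0\to T_{-1}\to\cdots)$ of projective modules such that $\operatorname{Hom}_R(T_\bullet,Q)$ is exact for every projective module $Q$. The Gorenstein projective dimension $\operatorname{Gpd}_R M$ is the infimum of the integers $m\ge 0$ for which there is an exact sequence $0\to G_m\to\cdots\to G_0\to M\to 0$ with every $G_i$ Gorenstein projective. Let $M$ be a finitely generated $(n,p)$-eventually periodic $R$-module with $\operatorname{Gpd}_R M=r<\infty$. Then: 1. $r\le n\le r+1$, and $\Omega^{r+p}(M)\oplus P\cong\Omega^{r}(M)$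 for some finitely generated projective $R$-module $P$. 2. $n=r$ if and only if the finitely generated module $\Omega^r(M)$ has no non-zero projective direct summand. 3. Suppose $n\ge 1$ and $\Omega^{n-1}(M)\cong X\oplus Q$, where $X$ is finitely generated without non-zero projective direct summands and $Q$ is finitely generated projective. Then $r=n-1$ if and only if $X\cong\Omega^{n+p-1}(M)$. -/

import Mathlib

universe u

namespace PeriodicModule

/-- `f : P → M` is a projective cover: `P` is projective and `f` is surjective with superfluous
kernel. -/
structure IsProjectiveCover {R : Type u} [Ring R] {P M : Type u} [AddCommGroup P] [Module R P]
    [AddCommGroup M] [Module R M] (f : P →ₗ[R] M) : Prop where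
  projective : Module.Projective R P
  surjective : Function.Surjective f
  superfluous : ∀ N : Submodule R P, N ⊔ LinearMap.ker f = ⊤ → N = ⊤

/-- `M` has a projective cover. -/
def HasProjectiveCover {R : Type u} [Ring R] (M : ModuleCat.{u} R) : Prop :=
  ∃ (P : ModuleCat.{u} R) (f : P →ₗ[R] M), IsProjectiveCover f

/-- Kernels of projective covers of the same module are isomorphic, so that the choice made in
the definition of the syzygy does not matter. -/
theorem IsProjectiveCover.nonempty_ker_equiv {R : Type u} [Ring R] {P Q M : Type u}
    [AddCommGroup P] [Module R P] [AddCommGroup Q] [Module R Q] [AddCommGroup M] [Module R M]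
    {f : P →ₗ[R] M} {g : Q →ₗ[R] M} (hf : IsProjectiveCover f) (hg : IsProjectiveCover g) :
    Nonempty (LinearMap.ker f ≃ₗ[R] LinearMap.ker g) := by
  have := hf.projective
  have := hg.projective
  obtain ⟨h, hh⟩ := Module.projective_lifting_property g f hg.surjective
  have hh' : ∀ x, g (h x) = f x := fun x => LinearMap.congr_fun hh x
  have hsurj : Function.Surjective h := by
    rw [← LinearMap.range_eq_top]
    apply hg.superfluous
    rw [eq_top_iff]
    intro y _
    obtain ⟨x, hx⟩ := hf.surjective (g y)
    refine Submodule.mem_sup.2 ⟨h x, ⟨x, rfl⟩, y - h x, ?_, by abel⟩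
    simp [hh', hx]
  obtain ⟨s, hs⟩ := Module.projective_lifting_property h LinearMap.id hsurj
  have hs' : ∀ y, h (s y) = y := fun y => LinearMap.congr_fun hs y
  have hssurj : Function.Surjective s := by
    rw [← LinearMap.range_eq_top]
    apply hf.superfluous
    rw [eq_top_iff]
    intro x _
    refine Submodule.mem_sup.2 ⟨s (h x), ⟨h x, rfl⟩, x - s (h x), ?_, by abel⟩
    rw [LinearMap.mem_ker, map_sub, ← hh' (s (h x)), hs', hh', sub_self]
  have hinj : Function.Injective h := by
    intro a b hab
    obtain ⟨a', rfl⟩ := hssurj a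
    obtain ⟨b', rfl⟩ := hssurj b
    rw [hs', hs'] at hab
    rw [hab]
  let e := LinearEquiv.ofBijective h ⟨hinj, hsurj⟩
  have hk : (LinearMap.ker f).map (e : P →ₗ[R] Q) = LinearMap.ker g := by
    ext y
    constructor
    · rintro ⟨x, hx, rfl⟩
      exact (hh' x).trans hx
    · intro hy
      obtain ⟨x, rfl⟩ := hsurj y
      exact ⟨x, (hh' x).symm.trans hy, rfl⟩
  exact ⟨(e.submoduleMap _).trans (LinearEquiv.ofEq _ _ hk)⟩

/-- Finitely generated modules over a left artinian ring have projective covers. -/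
theorem hasProjectiveCover_of_finite {R : Type u} [Ring R] [IsArtinianRing R]
    (M : ModuleCat.{u} R) [Module.Finite R M] : HasProjectiveCover M := by
  obtain ⟨n, π, hπ⟩ := Module.Finite.exists_fin' R M
  let F := Fin n → R
  let K : Submodule R F := LinearMap.ker π
  -- a minimal supplement `L` of `K`, and a minimal supplement `K'` of `L` inside `K`
  obtain ⟨L, hL, hLmin⟩ := (wellFounded_lt (α := Submodule R F)).has_min
    {L | L ⊔ K = ⊤} ⟨⊤, by simp⟩
  obtain ⟨K', ⟨hK', hK'K⟩, hKmin⟩ := (wellFounded_lt (α := Submodule R F)).has_min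
    {K' | L ⊔ K' = ⊤ ∧ K' ≤ K} ⟨K, hL, le_rfl⟩
  have hL0 : L ⊔ K = ⊤ := hL
  -- smallness in `L` and in `K'`
  have smallL : ∀ A ≤ L, ∀ B ≤ K, A ⊔ B = L → A = L := by
    intro A hA B hB hAB
    by_contra hne
    refine hLmin A ?_ (lt_of_le_of_ne hA hne)
    change A ⊔ K = ⊤
    rw [← hL0, ← hAB, sup_assoc, sup_eq_right.2 hB]
  have smallK : ∀ A ≤ K', ∀ B ≤ L, A ⊔ B = K' → A = K' := by
    intro A hA B hB hAB
    by_contra hne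
    refine hKmin A ⟨?_, hA.trans hK'K⟩ (lt_of_le_of_ne hA hne)
    rw [← hK', ← hAB, sup_comm A B, ← sup_assoc, sup_eq_left.2 hB]
  -- lift `F → F / K'` through `L → F / K'`
  have hsur : Function.Surjective (K'.mkQ ∘ₗ L.subtype) := by
    intro y
    obtain ⟨x, rfl⟩ := K'.mkQ_surjective y
    obtain ⟨l, hl, k, hk, rfl⟩ := Submodule.mem_sup.1 (hK' ▸ Submodule.mem_top : x ∈ L ⊔ K')
    refine ⟨⟨l, hl⟩, ?_⟩
    simp only [LinearMap.comp_apply, Submodule.subtype_apply, Submodule.mkQ_apply]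
    rw [Submodule.Quotient.eq]
    simpa using K'.neg_mem hk
  obtain ⟨f, hf⟩ := Module.projective_lifting_property (K'.mkQ ∘ₗ L.subtype) K'.mkQ hsur
  have hfx : ∀ x, (f x : F) - x ∈ K' := fun x => by
    have := LinearMap.congr_fun hf x
    simp only [LinearMap.comp_apply, Submodule.subtype_apply, Submodule.mkQ_apply] at this
    exact (Submodule.Quotient.eq _).1 this
  let φ : F →ₗ[R] F := L.subtype ∘ₗ f
  have hφL : ∀ x, φ x ∈ L := fun x => (f x).2
  have hφK' : ∀ x ∈ K', φ x ∈ K' := fun x hx => by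
    have := K'.add_mem (hfx x) hx
    simpa [φ] using this
  have hmapL : L.map φ = L := by
    refine smallL _ ?_ (L ⊓ K') (inf_le_right.trans hK'K) ?_
    · rintro _ ⟨x, _, rfl⟩
      exact hφL x
    · apply le_antisymm
      · refine sup_le ?_ inf_le_left
        rintro _ ⟨x, _, rfl⟩
        exact hφL x
      · intro x hx
        refine Submodule.mem_sup.2 ⟨φ x, ⟨x, hx, rfl⟩, x - φ x,
          ⟨L.sub_mem hx (hφL x), ?_⟩, by abel⟩
        have := K'.neg_mem (hfx x)
        simpa [φ] using this
  -- `φ` restricts to an automorphism of `L` and of `L ⊓ K'`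
  have hφLL : ∀ x ∈ L, φ x ∈ L := fun x _ => hφL x
  have hinjL : ∀ x ∈ L, φ x = 0 → x = 0 := by
    have hs : Function.Surjective (φ.restrict hφLL) := by
      rintro ⟨y, hy⟩
      rw [← hmapL] at hy
      obtain ⟨x, hx, hxy⟩ := hy
      exact ⟨⟨x, hx⟩, Subtype.ext hxy⟩
    have hi := IsNoetherian.injective_of_surjective_endomorphism _ hs
    intro x hx h0
    have : (⟨x, hx⟩ : L) = 0 := hi (by
      rw [map_zero]
      exact Subtype.ext h0)
    exact congrArg Subtype.val this
  let I : Submodule R F := L ⊓ K'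
  have hφI : ∀ x ∈ I, φ x ∈ I := fun x hx => ⟨hφL x, hφK' x hx.2⟩
  have hsurI : Function.Surjective (φ.restrict hφI) := by
    apply IsArtinian.surjective_of_injective_endomorphism
    rw [← LinearMap.ker_eq_bot, LinearMap.ker_eq_bot']
    rintro ⟨x, hx⟩ h0
    exact Subtype.ext (hinjL x hx.1 (congrArg Subtype.val h0))
  have hKer : K' ⊓ LinearMap.ker φ = K' := by
    refine smallK _ inf_le_left I inf_le_left (le_antisymm (sup_le inf_le_left inf_le_right) ?_)
    intro x hx
    obtain ⟨⟨y, hy⟩, hyx⟩ := hsurI ⟨φ x, hφL x, hφK' x hx⟩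
    have hyx' : φ y = φ x := congrArg (fun z : I => (z : F)) hyx
    refine Submodule.mem_sup.2 ⟨x - y, ⟨K'.sub_mem hx hy.2, ?_⟩, y, hy, by abel⟩
    simp [hyx']
  have hdisj : IsCompl L K' := by
    refine ⟨disjoint_iff.2 ((Submodule.eq_bot_iff _).2 ?_), codisjoint_iff.2 hK'⟩
    rintro x ⟨hxL, hxK⟩
    rw [SetLike.mem_coe, ← hKer] at hxK
    exact hinjL x hxL hxK.2
  have hproj : Module.Projective R L :=
    Module.Projective.of_split L.subtype (L.projectionOnto K' hdisj) (by
      ext x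
      simp)
  refine ⟨ModuleCat.of R L, π ∘ₗ L.subtype, hproj, ?_, ?_⟩
  · intro m
    obtain ⟨x, rfl⟩ := hπ m
    obtain ⟨l, hl, k, hk, rfl⟩ := Submodule.mem_sup.1 (hL0 ▸ Submodule.mem_top : x ∈ L ⊔ K)
    refine ⟨⟨l, hl⟩, ?_⟩
    have : π k = 0 := hk
    simp [this]
  · intro (N : Submodule R L) hN
    have hN' : N ⊔ LinearMap.ker (π ∘ₗ L.subtype) = ⊤ := hN
    have h1 : N.map L.subtype = L := by
      refine smallL _ (Submodule.map_subtype_le L N)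
        ((LinearMap.ker (π ∘ₗ L.subtype)).map L.subtype) ?_ ?_
      · rintro _ ⟨x, hx, rfl⟩
        exact hx
      · rw [← Submodule.map_sup, hN', Submodule.map_subtype_top]
    change N = ⊤
    rw [eq_top_iff]
    rintro ⟨x, hx⟩ _
    obtain ⟨y, hy, hyx⟩ := (h1.symm.le hx : x ∈ Submodule.map L.subtype N)
    have : y = ⟨x, hx⟩ := Subtype.ext hyx
    exact this ▸ hy

open Classical in
/-- The syzygy `Ω(M)`: the kernel of a (chosen) projective cover of `M`. The value `0` for a
module without projective cover is a convention that is never used over a left perfect ring, and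
in particular never over a left artinian ring. -/
noncomputable def syzygy {R : Type u} [Ring R] (M : ModuleCat.{u} R) : ModuleCat.{u} R :=
  if h : HasProjectiveCover M then
    ModuleCat.of R (LinearMap.ker h.choose_spec.choose)
  else ModuleCat.of R PUnit

/-- The `n`-th syzygy: `Ω⁰(M) = M` and `Ωⁿ⁺¹(M) = Ω(Ωⁿ(M))`. -/
noncomputable def nthSyzygy {R : Type u} [Ring R] : ℕ → ModuleCat.{u} R → ModuleCat.{u} R
  | 0, M => M
  | n + 1, M => syzygy (nthSyzygy n M)

/-- `M` is periodic: `Ωᵖ(M) ≅ M` for some `p > 0`. -/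
def IsPeriodic {R : Type u} [Ring R] (M : ModuleCat.{u} R) : Prop :=
  ∃ p : ℕ, 0 < p ∧ Nonempty (nthSyzygy p M ≃ₗ[R] M)

/-- `p` is the period of `M`: the smallest `p > 0` with `Ωᵖ(M) ≅ M`. -/
def HasPeriod {R : Type u} [Ring R] (M : ModuleCat.{u} R) (p : ℕ) : Prop :=
  IsLeast {q : ℕ | 0 < q ∧ Nonempty (nthSyzygy q M ≃ₗ[R] M)} p

/-- `M` is `(n, p)`-eventually periodic: `Ωⁿ(M)` is the first periodic syzygy of `M`, and its
period is `p`. -/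
def IsEventuallyPeriodic {R : Type u} [Ring R] (n p : ℕ) (M : ModuleCat.{u} R) : Prop :=
  IsLeast {k : ℕ | IsPeriodic (nthSyzygy k M)} n ∧ HasPeriod (nthSyzygy n M) p

/-- A totally acyclic complex `⋯ → T₁ → T₀ → T₋₁ → ⋯` of projective modules; `d i` is the
differential from `T (i + 1)` to `T i`. It is exact, and remains exact under `Hom(-, Q)` for every
projective module `Q`. -/
structure TotallyAcyclicComplex (R : Type u) [Ring R] where
  T : ℤ → ModuleCat.{u} R
  d : ∀ i : ℤ, T (i + 1) →ₗ[R] T i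
  projective : ∀ i, Module.Projective R (T i)
  exact : ∀ i, Function.Exact (d (i + 1)) (d i)
  hom_exact : ∀ Q : ModuleCat.{u} R, Module.Projective R Q → ∀ i,
    Function.Exact (fun g : T i →ₗ[R] Q => g ∘ₗ d i)
      (fun g : T (i + 1) →ₗ[R] Q => g ∘ₗ d (i + 1))

/-- `M` is Gorenstein projective: it is isomorphic to the cokernel of `T₁ → T₀` for a totally
acyclic complex `T`. -/
def IsGorensteinProjective {R : Type u} [Ring R] (M : ModuleCat.{u} R) : Prop :=
  ∃ C : TotallyAcyclicComplex R, Nonempty ((C.T 0 ⧸ LinearMap.range (C.d 0)) ≃ₗ[R] M)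

/-- There is an exact sequence `0 → Gₙ → ⋯ → G₁ → G₀ → M → 0` with all `Gᵢ` Gorenstein projective.
The sequence is continued to the left by zero modules. -/
def HasGorensteinProjectiveResolution {R : Type u} [Ring R] (n : ℕ) (M : ModuleCat.{u} R) : Prop :=
  ∃ (G : ℕ → ModuleCat.{u} R) (d : ∀ i, G (i + 1) →ₗ[R] G i) (ε : G 0 →ₗ[R] M),
    (∀ i ≤ n, IsGorensteinProjective (G i)) ∧ (∀ i, n < i → Subsingleton (G i)) ∧
    (∀ i, Function.Exact (d (i + 1)) (d i)) ∧ Function.Exact (d 0) ε ∧ Function.Surjective ε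

/-- The Gorenstein projective dimension: the infimum of the lengths of resolutions by Gorenstein
projective modules, `⊤` if there is none. -/
noncomputable def gpd {R : Type u} [Ring R] (M : ModuleCat.{u} R) : ℕ∞ :=
  ⨅ (n : ℕ) (_ : HasGorensteinProjectiveResolution n M), (n : ℕ∞)

/-- `M` is finitely generated and has no non-zero projective direct summand. -/
def HasNoProjectiveSummand {R : Type u} [Ring R] (M : ModuleCat.{u} R) : Prop :=
  Module.Finite R M ∧
    ∀ N N' : Submodule R M, IsCompl N N' → Module.Projective R N → N = ⊥

end PeriodicModule

open PeriodicModule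

/-!
Finite Gorenstein projective dimension enters only through the vanishing of `Ext` with projective
coefficients. Gorenstein projective modules have no higher `Ext` into projective modules, so a
resolution of `M` of length `r` gives `Extʲ(M, Q) = 0` for `j > r` and `Q` projective
(`HasGorensteinProjectiveResolution.extVanishesAbove`), and by dimension shifting all higher `Ext`
from `Ωᵏ(M)` to projective modules vanishes for `k ≥ r`. Conversely, a periodic module `N` whose
`Ext` into projective modules vanishes above some degree has none in positive degrees, being its
own syzygy of arbitrarily high order, and
splicing its projective covers gives a totally acyclic complex; thus `N`, and also `N ⊕ Q` for `Q`
projective, is Gorenstein projective (`isGorensteinProjective_of_periodic_prod`). In particular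
`Ωⁿ(M)` is Gorenstein projective, whence `r ≤ n`.

Call a module orthogonal if its higher `Ext` to projective modules vanishes.

* The syzygy of an orthogonal module has no non-zero projective summand
  (`ExtVanishesAbove.hasNoProjectiveSummand_syzygy`).
* If `A` and `B` are orthogonal with `Ω(A) ≅ Ω(B)`, and `B` has no non-zero projective summand,
  then `A ≅ B ⊕ P` with `P` projective (`ExtVanishesAbove.exists_equiv_prod`).

By the second fact, the periodicity `Ωᵏ⁺ᵖ(M) ≅ Ωᵏ(M)`, valid for large `k`, descends to
`k = r + 1`, which gives `n ≤ r + 1`; one more step gives `Ωʳ(M) ≅ Ωʳ⁺ᵖ(M) ⊕ P`. The remaining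
assertions compare `Ωʳ(M)`, or its part `X` without projective summands, with `Ωʳ⁺ᵖ(M)`, using
both facts again.
-/

/-! ### Linear algebra, projective summands and recovering a module from its syzygy -/

namespace PeriodicModule

section LinearAlgebra

variable {R : Type u} [Ring R]

theorem exists_comp_eq_of_ker_le {P A B : Type u} [AddCommGroup P] [Module R P]
    [AddCommGroup A] [Module R A] [AddCommGroup B] [Module R B] (π : P →ₗ[R] A)
    (hπ : Function.Surjective π) (g : P →ₗ[R] B) (h : LinearMap.ker π ≤ LinearMap.ker g) :
    ∃ f : A →ₗ[R] B, ∀ x, f (π x) = g x := by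
  refine ⟨(LinearMap.ker π).liftQ g h ∘ₗ (π.quotKerEquivOfSurjective hπ).symm, fun x => ?_⟩
  have : (π.quotKerEquivOfSurjective hπ).symm (π x) = Submodule.Quotient.mk x := by
    rw [LinearEquiv.symm_apply_eq]
    rfl
  simp [this]

theorem projective_ker_of_surjective {P Q : Type u} [AddCommGroup P] [Module R P]
    [AddCommGroup Q] [Module R Q] [Module.Projective R P] [Module.Projective R Q] (f : P →ₗ[R] Q)
    (hf : Function.Surjective f) : Module.Projective R (LinearMap.ker f) := by
  obtain ⟨s, hs⟩ := Module.projective_lifting_property f LinearMap.id hf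
  have hs' : ∀ y, f (s y) = y := fun y => LinearMap.congr_fun hs y
  refine Module.Projective.of_split (LinearMap.ker f).subtype
    ((LinearMap.id - s ∘ₗ f).codRestrict (LinearMap.ker f) fun x => by simp [hs']) ?_
  ext x
  simp

theorem projective_of_isCompl {P : Type u} [AddCommGroup P] [Module R P] [Module.Projective R P]
    {N N' : Submodule R P} (h : IsCompl N N') : Module.Projective R N :=
  Module.Projective.of_split N.subtype (N.projectionOnto N' h) (by ext x; simp)

theorem nonempty_equiv_prod_ker {A B : Type u} [AddCommGroup A] [Module R A]
    [AddCommGroup B] [Module R B] (f : A →ₗ[R] B) (s : B →ₗ[R] A) (hs : ∀ b, f (s b) = b) :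
    Nonempty (A ≃ₗ[R] B × LinearMap.ker f) := by
  refine ⟨LinearEquiv.ofLinearMap
    (f.prod ((LinearMap.id - s ∘ₗ f).codRestrict (LinearMap.ker f) fun x => by simp [hs]))
    (s.coprod (LinearMap.ker f).subtype) ?_ ?_⟩
  · ext x <;> simp [hs]
  · ext x
    simp

/-- A morphism of short exact sequences which is an isomorphism on the left induces an isomorphism
between the kernels of the middle and the right components. -/
theorem nonempty_ker_equiv_ker {K K' P P' A B : Type u} [AddCommGroup K] [Module R K]
    [AddCommGroup K'] [Module R K'] [AddCommGroup P] [Module R P] [AddCommGroup P'] [Module R P']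
    [AddCommGroup A] [Module R A] [AddCommGroup B] [Module R B]
    {ι : K →ₗ[R] P} {π : P →ₗ[R] A} {ι' : K' →ₗ[R] P'} {π' : P' →ₗ[R] B}
    (hπ : Function.Exact ι π) (hs : Function.Surjective π)
    (hι' : Function.Injective ι') (hπ' : Function.Exact ι' π')
    (e : K ≃ₗ[R] K') (f : P →ₗ[R] P') (g : A →ₗ[R] B) (h₁ : ∀ x, f (ι x) = ι' (e x))
    (h₂ : ∀ x, g (π x) = π' (f x)) :
    Nonempty (LinearMap.ker f ≃ₗ[R] LinearMap.ker g) := by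
  let k : LinearMap.ker f →ₗ[R] LinearMap.ker g :=
    (π ∘ₗ (LinearMap.ker f).subtype).codRestrict _ fun x => by
      have : f x = 0 := x.2
      simp [h₂, this]
  refine ⟨LinearEquiv.ofBijective k ⟨?_, ?_⟩⟩
  · rw [← LinearMap.ker_eq_bot, LinearMap.ker_eq_bot']
    rintro ⟨x, hx⟩ h0
    have hx0 : π x = 0 := congrArg Subtype.val h0
    obtain ⟨y, rfl⟩ := (hπ x).1 hx0
    have h3 : ι' (e y) = 0 := by
      rw [← h₁]
      exact hx
    have : y = 0 := by simpa using (map_eq_zero_iff ι' hι').1 h3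
    ext
    simp [this]
  · rintro ⟨a, ha⟩
    obtain ⟨x, rfl⟩ := hs a
    have h3 : π' (f x) = 0 := by
      rw [← h₂]
      exact ha
    obtain ⟨y, hy⟩ := (hπ' _).1 h3
    refine ⟨⟨x - ι (e.symm y), ?_⟩, ?_⟩
    · simp [h₁, hy]
    · ext
      change π (x - ι (e.symm y)) = π x
      rw [map_sub, hπ.apply_apply_eq_zero, sub_zero]

end LinearAlgebra

section ProjectiveSummand

variable {R : Type u} [Ring R]

theorem HasNoProjectiveSummand.congr {A B : ModuleCat.{u} R} (hA : HasNoProjectiveSummand A)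
    (e : A ≃ₗ[R] B) : HasNoProjectiveSummand B := by
  have := hA.1
  refine ⟨Module.Finite.equiv e, fun N N' hN hP => ?_⟩
  have h : N.map (e.symm : B →ₗ[R] A) = ⊥ := by
    refine hA.2 _ (N'.map (e.symm : B →ₗ[R] A))
      ((Submodule.orderIsoMapComap e.symm).isCompl hN) ?_
    exact Module.Projective.of_equiv (e.symm.submoduleMap N)
  exact (Submodule.map_eq_bot_iff (p := N) (e := e.symm)).1 h

theorem HasNoProjectiveSummand.nonempty_equiv_of_prod {A B C : ModuleCat.{u} R}
    (hA : HasNoProjectiveSummand A) (hC : Module.Projective R C) (e : A ≃ₗ[R] B × C) :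
    Nonempty (A ≃ₗ[R] B) := by
  have h := hA.congr (B := ModuleCat.of R (B × C)) e
  have h0 : LinearMap.range (LinearMap.inr R B C) = ⊥ :=
    h.2 _ _ LinearMap.isCompl_range_inl_inr.symm
      (Module.Projective.of_equiv (LinearEquiv.ofInjective (LinearMap.inr R B C)
        LinearMap.inr_injective))
  have hC0 : ∀ c : C, c = 0 := fun c => by
    have : (LinearMap.inr R B C c) ∈ LinearMap.range (LinearMap.inr R B C) := ⟨c, rfl⟩
    rw [h0, Submodule.mem_bot] at this
    exact congrArg Prod.snd this
  have : Subsingleton C := ⟨fun a b => by rw [hC0 a, hC0 b]⟩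
  refine ⟨e.trans (LinearEquiv.ofBijective (LinearMap.fst R B C) ⟨?_, LinearMap.fst_surjective⟩)⟩
  rintro ⟨a, c⟩ ⟨a', c'⟩ h
  exact Prod.ext h (Subsingleton.elim _ _)

/-- Modules `A` and `B` with the same syzygy differ by a projective summand, provided that maps
from the syzygy to projective modules extend along `ι` and `ι'` and `B` has no non-zero projective
summand. The extensions of the isomorphism of syzygies and of its inverse induce maps `A → B → A`,
and the Fitting decomposition of the composite `B → B` has a projective kernel part, which must
vanish. -/
theorem HasNoProjectiveSummand.exists_equiv_prod_of_syzygy_equiv [IsArtinianRing R]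
    {K K' P P' A B : ModuleCat.{u} R}
    {ι : K →ₗ[R] P} {π : P →ₗ[R] A} {ι' : K' →ₗ[R] P'} {π' : P' →ₗ[R] B}
    [Module.Finite R P] [Module.Finite R P'] [Module.Projective R P] [Module.Projective R P']
    (hπ : Function.Exact ι π) (hs : Function.Surjective π)
    (hι' : Function.Injective ι') (hπ' : Function.Exact ι' π') (hs' : Function.Surjective π')
    (hext : ∀ g : K →ₗ[R] P', ∃ h : P →ₗ[R] P', ∀ x, h (ι x) = g x)
    (hext' : ∀ g : K' →ₗ[R] P, ∃ h : P' →ₗ[R] P, ∀ x, h (ι' x) = g x)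
    (hB : HasNoProjectiveSummand B) (e : K ≃ₗ[R] K') :
    ∃ C : ModuleCat.{u} R, Module.Finite R C ∧ Module.Projective R C ∧
      Nonempty (A ≃ₗ[R] B × C) := by
  have := hB.1
  obtain ⟨f, hf⟩ := hext (ι' ∘ₗ e)
  obtain ⟨g, hg⟩ := hext' (ι ∘ₗ e.symm)
  simp only [LinearMap.comp_apply, LinearEquiv.coe_coe] at hf hg
  obtain ⟨f', hf'⟩ := exists_comp_eq_of_ker_le π hs (π' ∘ₗ f) (fun x hx => by
    obtain ⟨y, rfl⟩ := (hπ x).1 hx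
    simp [hf, hπ'.apply_apply_eq_zero])
  obtain ⟨g', hg'⟩ := exists_comp_eq_of_ker_le π' hs' (π ∘ₗ g) (fun x hx => by
    obtain ⟨y, rfl⟩ := (hπ' x).1 hx
    simp [hg, hπ.apply_apply_eq_zero])
  simp only [LinearMap.comp_apply] at hf' hg'
  let φ : Module.End R P' := f ∘ₗ g
  let ψ : Module.End R B := f' ∘ₗ g'
  have hφ : ∀ k x, (φ ^ k) (ι' x) = ι' x := by
    intro k x
    induction k with
    | zero => simp
    | succ k ih => rw [pow_succ', Module.End.mul_apply, ih]; simp [φ, hg, hf]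
  have hψ : ∀ k x, (ψ ^ k) (π' x) = π' ((φ ^ k) x) := by
    intro k x
    induction k with
    | zero => simp
    | succ k ih =>
      rw [pow_succ', Module.End.mul_apply, ih, pow_succ', Module.End.mul_apply]
      simp [φ, ψ, hg', hf']
  have hker : ∀ k, Nonempty (LinearMap.ker (φ ^ k) ≃ₗ[R] LinearMap.ker (ψ ^ k)) := fun k =>
    nonempty_ker_equiv_ker hπ' hs' hι' hπ' (LinearEquiv.refl R K') _ _ (hφ k) (hψ k)
  obtain ⟨k, hk, hk', hk0⟩ := ((φ.eventually_isCompl_ker_pow_range_pow).and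
    ((ψ.eventually_isCompl_ker_pow_range_pow).and (Filter.eventually_gt_atTop 0))).exists
  have hψ0 : LinearMap.ker (ψ ^ k) = ⊥ := by
    have := projective_of_isCompl hk
    exact hB.2 _ _ hk' (Module.Projective.of_equiv (hker k).some)
  have hinj : Function.Injective ψ := by
    rw [← LinearMap.ker_eq_bot, eq_bot_iff, ← hψ0]
    intro x hx
    obtain ⟨m, rfl⟩ : ∃ m, k = m + 1 := ⟨k - 1, by omega⟩
    have : ψ x = 0 := hx
    simp [pow_succ, this]
  let E : B ≃ₗ[R] B := LinearEquiv.ofBijective ψ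
    ⟨hinj, IsArtinian.surjective_of_injective_endomorphism ψ hinj⟩
  have hE : ∀ b, f' (g' (E.symm b)) = b := fun b => E.apply_symm_apply b
  -- `φ` is bijective as well, so that `f` is a surjection onto a projective module
  have hφinj : Function.Injective φ := by
    have h1 := (hker 1).some
    rw [pow_one, pow_one, LinearMap.ker_eq_bot.2 hinj] at h1
    rw [← LinearMap.ker_eq_bot, LinearMap.ker_eq_bot']
    intro x hx
    have h2 : (⟨x, hx⟩ : LinearMap.ker φ) = 0 := h1.injective (Subsingleton.elim _ _)
    exact congrArg Subtype.val h2
  have hfs : Function.Surjective f := fun y => by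
    obtain ⟨x, hx⟩ := IsArtinian.surjective_of_injective_endomorphism φ hφinj y
    exact ⟨g x, hx⟩
  have := projective_ker_of_surjective f hfs
  obtain ⟨c⟩ := nonempty_ker_equiv_ker hπ hs hι' hπ' e f f' hf hf'
  have hfin : Module.Finite R (LinearMap.ker f) := inferInstance
  exact ⟨ModuleCat.of R (LinearMap.ker f'), Module.Finite.equiv c, Module.Projective.of_equiv c,
    nonempty_equiv_prod_ker f' (g' ∘ₗ E.symm) hE⟩

end ProjectiveSummand

end PeriodicModule

/-! ### Vanishing of `Ext` with projective coefficients -/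

namespace PeriodicModule

section Ext

open CategoryTheory Abelian

variable {R : Type u} [Ring R]

/-- `Ext` groups of `M` with values in projective modules vanish in all degrees above `s`. -/
def ExtVanishesAbove (s : ℕ) (M : ModuleCat.{u} R) : Prop :=
  ∀ Q : ModuleCat.{u} R, Module.Projective R Q → ∀ j, s < j → Subsingleton (Ext M Q j)

theorem shortExact_moduleCatMk {K P M : ModuleCat.{u} R} {ι : K →ₗ[R] P} {π : P →ₗ[R] M}
    (hι : Function.Injective ι) (hπ : Function.Exact ι π) (hs : Function.Surjective π) :
    (ShortComplex.moduleCatMk ι π hπ.linearMap_comp_eq_zero).ShortExact where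
  exact := (ShortComplex.ShortExact.moduleCat_exact_iff_function_exact _).2 hπ
  mono_f := (ModuleCat.mono_iff_injective _).2 hι
  epi_g := (ModuleCat.epi_iff_surjective _).2 hs

theorem ExtVanishesAbove.mono {s t : ℕ} {M : ModuleCat.{u} R} (h : ExtVanishesAbove s M)
    (hst : s ≤ t) : ExtVanishesAbove t M :=
  fun Q hQ j hj => h Q hQ j (by omega)

theorem extVanishesAbove_of_projective {M : ModuleCat.{u} R} (hM : Module.Projective R M) (s : ℕ) :
    ExtVanishesAbove s M := by
  intro Q _ j hj
  obtain ⟨i, rfl⟩ : ∃ i, j = i + 1 := ⟨j - 1, by omega⟩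
  have : Projective M := M.projective_of_categoryTheory_projective
  exact Ext.subsingleton_of_projective M Q i

theorem subsingleton_ext_of_retract {M N Q : ModuleCat.{u} R} (i : M →ₗ[R] N) (p : N →ₗ[R] M)
    (h : ∀ x, p (i x) = x) (j : ℕ) (hN : Subsingleton (Ext N Q j)) : Subsingleton (Ext M Q j) := by
  refine subsingleton_of_forall_eq 0 fun x => ?_
  have h1 : ModuleCat.ofHom i ≫ ModuleCat.ofHom p = 𝟙 M := by
    ext x
    exact h x
  rw [← Ext.mk₀_id_comp x, ← h1, ← Ext.mk₀_comp_mk₀_assoc,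
    Subsingleton.elim ((Ext.mk₀ (ModuleCat.ofHom p)).comp x (zero_add j)) 0, Ext.comp_zero]

theorem ExtVanishesAbove.of_retract {s : ℕ} {M N : ModuleCat.{u} R} (hN : ExtVanishesAbove s N)
    (i : M →ₗ[R] N) (p : N →ₗ[R] M) (h : ∀ x, p (i x) = x) : ExtVanishesAbove s M :=
  fun Q hQ j hj => subsingleton_ext_of_retract i p h j (hN Q hQ j hj)

theorem ExtVanishesAbove.congr {s : ℕ} {M N : ModuleCat.{u} R} (hN : ExtVanishesAbove s N)
    (e : N ≃ₗ[R] M) : ExtVanishesAbove s M :=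
  hN.of_retract (e.symm : M →ₗ[R] N) e (by simp)

section ShortExact

variable {K P M : ModuleCat.{u} R} {ι : K →ₗ[R] P} {π : P →ₗ[R] M}

theorem ExtVanishesAbove.middle {s : ℕ} (hι : Function.Injective ι) (hπ : Function.Exact ι π)
    (hs : Function.Surjective π) (hK : ExtVanishesAbove s K) (hM : ExtVanishesAbove s M) :
    ExtVanishesAbove s P := by
  intro Q hQ j hj
  have := hK Q hQ j hj
  have := hM Q hQ j hj
  refine subsingleton_of_forall_eq 0 fun x => ?_
  obtain ⟨y, rfl⟩ := Ext.contravariant_sequence_exact₂ (shortExact_moduleCatMk hι hπ hs) _ x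
    (Subsingleton.elim (α := Ext K Q j) _ _)
  have hy : y = 0 := Subsingleton.elim (α := Ext M Q j) y 0
  rw [hy, Ext.comp_zero]
  rfl

theorem subsingleton_ext_succ (hι : Function.Injective ι)
    (hπ : Function.Exact ι π) (hs : Function.Surjective π) (hP : Module.Projective R P)
    {Q : ModuleCat.{u} R} (hQ : Module.Projective R Q) {j : ℕ} (hK : Subsingleton (Ext K Q j)) :
    Subsingleton (Ext M Q (j + 1)) := by
  have := extVanishesAbove_of_projective hP 0 Q hQ (j + 1) (by omega)
  refine subsingleton_of_forall_eq 0 fun x => ?_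
  obtain ⟨y, rfl⟩ := Ext.contravariant_sequence_exact₃ (shortExact_moduleCatMk hι hπ hs) _ x
    (Subsingleton.elim (α := Ext P Q (j + 1)) _ _) (add_comm 1 j)
  have hy : y = 0 := Subsingleton.elim (α := Ext K Q j) y 0
  rw [hy, Ext.comp_zero]
  rfl

theorem ExtVanishesAbove.right {s : ℕ} (hι : Function.Injective ι) (hπ : Function.Exact ι π)
    (hs : Function.Surjective π) (hK : ExtVanishesAbove s K) (hP : ExtVanishesAbove (s + 1) P) :
    ExtVanishesAbove (s + 1) M := by
  intro Q hQ j hj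
  obtain ⟨i, rfl⟩ : ∃ i, j = 1 + i := ⟨j - 1, by omega⟩
  have := hK Q hQ i (by omega)
  have := hP Q hQ (1 + i) hj
  refine subsingleton_of_forall_eq 0 fun x => ?_
  obtain ⟨y, rfl⟩ := Ext.contravariant_sequence_exact₃ (shortExact_moduleCatMk hι hπ hs) _ x
    (Subsingleton.elim (α := Ext P Q (1 + i)) _ _) rfl
  have hy : y = 0 := Subsingleton.elim (α := Ext K Q i) y 0
  rw [hy, Ext.comp_zero]
  rfl

theorem ExtVanishesAbove.syzygy_of_shortExact {s : ℕ} (hι : Function.Injective ι)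
    (hπ : Function.Exact ι π) (hs : Function.Surjective π) (hP : Module.Projective R P)
    (hM : ExtVanishesAbove s M) : ExtVanishesAbove (s - 1) K := by
  intro Q hQ j hj
  have := hM Q hQ (1 + j) (by omega)
  have := extVanishesAbove_of_projective hP 0 Q hQ j (by omega)
  refine subsingleton_of_forall_eq 0 fun x => ?_
  obtain ⟨y, rfl⟩ := Ext.contravariant_sequence_exact₁ (shortExact_moduleCatMk hι hπ hs) _ x rfl
    (Subsingleton.elim (α := Ext M Q (1 + j)) _ _)
  have hy : y = 0 := Subsingleton.elim (α := Ext P Q j) y 0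
  rw [hy, Ext.comp_zero]
  rfl

theorem ExtVanishesAbove.exists_extension (hι : Function.Injective ι)
    (hπ : Function.Exact ι π) (hs : Function.Surjective π) (hM : ExtVanishesAbove 0 M)
    {Q : ModuleCat.{u} R} (hQ : Module.Projective R Q) (g : K →ₗ[R] Q) :
    ∃ h : P →ₗ[R] Q, ∀ x, h (ι x) = g x := by
  have := hM Q hQ 1 one_pos
  obtain ⟨y, hy⟩ := Ext.contravariant_sequence_exact₁ (shortExact_moduleCatMk hι hπ hs) Q
    (Ext.mk₀ (ModuleCat.ofHom g)) (n₁ := 1) rfl (Subsingleton.elim (α := Ext M Q 1) _ _)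
  obtain ⟨h, rfl⟩ := (Ext.mk₀_bijective _ _).2 y
  rw [Ext.mk₀_comp_mk₀] at hy
  have h1 := (Ext.mk₀_bijective _ _).1 hy
  exact ⟨h.hom, fun x => congr($(h1).hom x)⟩

theorem subsingleton_ext_one_of_extension (hι : Function.Injective ι)
    (hπ : Function.Exact ι π) (hs : Function.Surjective π) (hP : Module.Projective R P)
    {Q : ModuleCat.{u} R} (hQ : Module.Projective R Q)
    (hext : ∀ g : K →ₗ[R] Q, ∃ h : P →ₗ[R] Q, ∀ x, h (ι x) = g x) : Subsingleton (Ext M Q 1) := by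
  have := extVanishesAbove_of_projective hP 0 Q hQ 1 one_pos
  refine subsingleton_of_forall_eq 0 fun x => ?_
  obtain ⟨y, rfl⟩ := Ext.contravariant_sequence_exact₃ (shortExact_moduleCatMk hι hπ hs) _ x
    (Subsingleton.elim (α := Ext P Q 1) _ _) (n₀ := 0) rfl
  obtain ⟨g, rfl⟩ := (Ext.mk₀_bijective _ _).2 y
  obtain ⟨h, rfl⟩ : ∃ h : (ShortComplex.moduleCatMk ι π hπ.linearMap_comp_eq_zero).X₂ ⟶ Q,
      g = (ShortComplex.moduleCatMk ι π hπ.linearMap_comp_eq_zero).f ≫ h := by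
    obtain ⟨h, hh⟩ := hext g.hom
    refine ⟨ModuleCat.ofHom h, ?_⟩
    ext x
    exact (hh x).symm
  rw [← Ext.mk₀_comp_mk₀, ShortComplex.ShortExact.extClass_comp_assoc]
  rfl

end ShortExact

end Ext

end PeriodicModule

/-! ### Syzygies over left artinian rings -/

namespace PeriodicModule

section Syzygy

variable {R : Type u} [Ring R]

theorem IsProjectiveCover.nonempty_syzygy_equiv {P M : ModuleCat.{u} R} {f : P →ₗ[R] M}
    (hf : IsProjectiveCover f) : Nonempty (syzygy M ≃ₗ[R] LinearMap.ker f) := by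
  have h : HasProjectiveCover M := ⟨P, f, hf⟩
  have h1 : syzygy M = ModuleCat.of R (LinearMap.ker h.choose_spec.choose) := dif_pos h
  rw [h1]
  exact h.choose_spec.choose_spec.nonempty_ker_equiv hf

theorem IsProjectiveCover.finite {P M : ModuleCat.{u} R} {f : P →ₗ[R] M}
    (hf : IsProjectiveCover f) [Module.Finite R M] : Module.Finite R P := by
  obtain ⟨n, g, hg⟩ := Module.Finite.exists_fin' R M
  obtain ⟨h, hh⟩ := Module.projective_lifting_property f g hf.surjective
  refine Module.Finite.of_surjective h (LinearMap.range_eq_top.1 (hf.superfluous _ ?_))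
  rw [eq_top_iff]
  intro x _
  obtain ⟨y, hy⟩ := hg (f x)
  refine Submodule.mem_sup.2 ⟨h y, ⟨y, rfl⟩, x - h y, ?_, by abel⟩
  have : f (h y) = g y := LinearMap.congr_fun hh y
  simp [this, hy]

theorem nthSyzygy_add (M : ModuleCat.{u} R) (a b : ℕ) :
    nthSyzygy (a + b) M = nthSyzygy b (nthSyzygy a M) := by
  induction b with
  | zero => rfl
  | succ b ih => exact congrArg syzygy ih

variable [IsArtinianRing R]

theorem exists_syzygy_shortExact (M : ModuleCat.{u} R) [Module.Finite R M] :
    ∃ (P : ModuleCat.{u} R) (ι : syzygy M →ₗ[R] P) (π : P →ₗ[R] M), Module.Finite R P ∧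
      Module.Projective R P ∧ Function.Injective ι ∧ Function.Exact ι π ∧
      Function.Surjective π ∧ IsProjectiveCover π := by
  obtain ⟨P, f, hf⟩ := hasProjectiveCover_of_finite M
  obtain ⟨e⟩ := hf.nonempty_syzygy_equiv
  refine ⟨P, (LinearMap.ker f).subtype ∘ₗ e, f, hf.finite, hf.projective, ?_, ?_, hf.surjective,
    hf⟩
  · exact (LinearMap.ker f).injective_subtype.comp e.injective
  · intro x
    constructor
    · intro hx
      exact ⟨e.symm ⟨x, hx⟩, by simp⟩
    · rintro ⟨y, rfl⟩
      exact (e y).2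

theorem finite_syzygy (M : ModuleCat.{u} R) [Module.Finite R M] : Module.Finite R (syzygy M) := by
  obtain ⟨P, ι, π, _, _, hι, -⟩ := exists_syzygy_shortExact M
  exact Module.Finite.of_injective ι hι

theorem finite_nthSyzygy (M : ModuleCat.{u} R) [Module.Finite R M] (k : ℕ) :
    Module.Finite R (nthSyzygy k M) := by
  induction k with
  | zero => assumption
  | succ k ih => exact finite_syzygy _

theorem syzygy_congr {M N : ModuleCat.{u} R} [Module.Finite R M] (e : M ≃ₗ[R] N) :
    Nonempty (syzygy M ≃ₗ[R] syzygy N) := by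
  obtain ⟨P, f, hf⟩ := hasProjectiveCover_of_finite M
  have hk : LinearMap.ker ((e : M →ₗ[R] N) ∘ₗ f) = LinearMap.ker f := LinearEquiv.ker_comp e f
  have hg : IsProjectiveCover ((e : M →ₗ[R] N) ∘ₗ f) :=
    ⟨hf.projective, e.surjective.comp hf.surjective, fun N hN => hf.superfluous N (hk ▸ hN)⟩
  obtain ⟨e₁⟩ := hf.nonempty_syzygy_equiv
  obtain ⟨e₂⟩ := hg.nonempty_syzygy_equiv
  exact ⟨e₁.trans ((LinearEquiv.ofEq _ _ hk.symm).trans e₂.symm)⟩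

theorem nthSyzygy_congr {M N : ModuleCat.{u} R} [Module.Finite R M] (e : M ≃ₗ[R] N) (k : ℕ) :
    Nonempty (nthSyzygy k M ≃ₗ[R] nthSyzygy k N) := by
  induction k with
  | zero => exact ⟨e⟩
  | succ k ih =>
    have := finite_nthSyzygy M k
    exact syzygy_congr ih.some

/-- Projective summands do not contribute to the syzygy. -/
theorem nonempty_syzygy_equiv_of_prod {A X Q : ModuleCat.{u} R} [Module.Finite R X]
    [Module.Finite R Q] (hQ : Module.Projective R Q) (e : A ≃ₗ[R] X × Q) :
    Nonempty (syzygy A ≃ₗ[R] syzygy X) := by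
  obtain ⟨P, f, hf⟩ := hasProjectiveCover_of_finite X
  have hP := hf.projective
  let g : ModuleCat.of R (P × Q) →ₗ[R] ModuleCat.of R (X × Q) := f.prodMap LinearMap.id
  have hk : (LinearMap.ker f).map (LinearMap.inl R P Q) = LinearMap.ker g := by
    ext ⟨x, q⟩
    constructor
    · rintro ⟨y, hy, h⟩
      have hy0 : f y = 0 := hy
      rw [← h]
      exact Prod.ext hy0 rfl
    · intro h
      have h1 : f x = 0 := congrArg Prod.fst h
      have h2 : q = 0 := congrArg Prod.snd h
      exact ⟨x, h1, by simp [h2]⟩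
  have hg : IsProjectiveCover g := by
    refine ⟨inferInstanceAs (Module.Projective R (P × Q)), ?_, fun N hN => ?_⟩
    · exact hf.surjective.prodMap Function.surjective_id
    · have h1 : N.comap (LinearMap.inl R P Q) = ⊤ := by
        refine hf.superfluous _ (eq_top_iff.2 fun x _ => ?_)
        have hx : LinearMap.inl R P Q x ∈ N ⊔ LinearMap.ker g := hN ▸ Submodule.mem_top
        rw [← hk] at hx
        obtain ⟨n, hn, _, ⟨k, hk', rfl⟩, h⟩ := Submodule.mem_sup.1 hx
        refine Submodule.mem_sup.2 ⟨x - k, ?_, k, hk', by abel⟩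
        have : LinearMap.inl R P Q (x - k) = n := by
          rw [map_sub, ← h, add_sub_cancel_right]
        rw [Submodule.mem_comap, this]
        exact hn
      rw [← hN, eq_comm, sup_eq_left, ← hk, Submodule.map_le_iff_le_comap, h1]
      exact le_top
  obtain ⟨e₁⟩ := hf.nonempty_syzygy_equiv
  obtain ⟨e₂⟩ := hg.nonempty_syzygy_equiv
  have : Module.Finite R (ModuleCat.of R (X × Q)) := inferInstanceAs (Module.Finite R (X × Q))
  have : Module.Finite R A := Module.Finite.equiv e.symm
  obtain ⟨e₃⟩ := syzygy_congr (N := ModuleCat.of R (X × Q)) e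
  exact ⟨e₃.trans (e₂.trans ((LinearEquiv.ofEq _ _ hk.symm).trans
    ((Submodule.equivMapOfInjective _ LinearMap.inl_injective _).symm.trans e₁.symm)))⟩

theorem ExtVanishesAbove.syzygy {s : ℕ} {M : ModuleCat.{u} R} [Module.Finite R M]
    (hM : ExtVanishesAbove s M) : ExtVanishesAbove (s - 1) (syzygy M) := by
  obtain ⟨P, ι, π, -, hP, hι, hπ, hs, -⟩ := exists_syzygy_shortExact M
  exact hM.syzygy_of_shortExact hι hπ hs hP

theorem ExtVanishesAbove.nthSyzygy {s : ℕ} {M : ModuleCat.{u} R} [Module.Finite R M]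
    (hM : ExtVanishesAbove s M) (k : ℕ) : ExtVanishesAbove (s - k) (nthSyzygy k M) := by
  induction k with
  | zero => exact hM
  | succ k ih =>
    have := finite_nthSyzygy M k
    exact ih.syzygy

/-- A projective summand `N` of the syzygy of `M` would split off the projective cover `P` of `M`
too, because the projection to `N` extends to `P`; but the syzygy is superfluous in `P`. -/
theorem ExtVanishesAbove.hasNoProjectiveSummand_syzygy {M : ModuleCat.{u} R} [Module.Finite R M]
    (hM : ExtVanishesAbove 0 M) : HasNoProjectiveSummand (PeriodicModule.syzygy M) := by
  refine ⟨finite_syzygy M, fun N N' hN hNP => ?_⟩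
  obtain ⟨P, ι, π, -, hP, hι, hπ, hs, hcov⟩ := exists_syzygy_shortExact M
  obtain ⟨h, hh⟩ := hM.exists_extension hι hπ hs (Q := ModuleCat.of R N) hNP
    (N.projectionOnto N' hN)
  have hker : LinearMap.ker h = ⊤ := by
    refine hcov.superfluous _ (eq_top_iff.2 fun x _ => ?_)
    refine Submodule.mem_sup.2 ⟨x - ι (h x : N), ?_, ι (h x : N), hπ.apply_apply_eq_zero _,
      by abel⟩
    rw [LinearMap.mem_ker, map_sub, hh, sub_eq_zero]
    exact (Submodule.projectionOnto_apply_left hN _).symm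
  rw [Submodule.eq_bot_iff]
  intro x hx
  have h1 : h (ι x) = 0 := by
    rw [← LinearMap.mem_ker, hker]
    exact Submodule.mem_top
  rw [hh] at h1
  have h2 := Submodule.projectionOnto_apply_left hN ⟨x, hx⟩
  exact congrArg Subtype.val (h2.symm.trans h1)

/-- A module with vanishing `Ext` is determined by its syzygy up to projective summands. -/
theorem ExtVanishesAbove.exists_equiv_prod {A B : ModuleCat.{u} R} [Module.Finite R A]
    (hA : ExtVanishesAbove 0 A) (hB : ExtVanishesAbove 0 B) (hB' : HasNoProjectiveSummand B)
    (e : PeriodicModule.syzygy A ≃ₗ[R] PeriodicModule.syzygy B) :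
    ∃ C : ModuleCat.{u} R, Module.Finite R C ∧ Module.Projective R C ∧
      Nonempty (A ≃ₗ[R] B × C) := by
  have := hB'.1
  obtain ⟨P, ι, π, _, hP, hι, hπ, hs, -⟩ := exists_syzygy_shortExact A
  obtain ⟨P', ι', π', _, hP', hι', hπ', hs', -⟩ := exists_syzygy_shortExact B
  exact hB'.exists_equiv_prod_of_syzygy_equiv hπ hs hι' hπ' hs'
    (hA.exists_extension hι hπ hs hP') (hB.exists_extension hι' hπ' hs' hP) e

theorem ExtVanishesAbove.nonempty_equiv {A B : ModuleCat.{u} R}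
    (hA : ExtVanishesAbove 0 A) (hB : ExtVanishesAbove 0 B) (hA' : HasNoProjectiveSummand A)
    (hB' : HasNoProjectiveSummand B)
    (e : PeriodicModule.syzygy A ≃ₗ[R] PeriodicModule.syzygy B) : Nonempty (A ≃ₗ[R] B) := by
  have := hA'.1
  obtain ⟨C, -, hC, ⟨f⟩⟩ := hA.exists_equiv_prod hB hB' e
  exact hA'.nonempty_equiv_of_prod hC f

end Syzygy

end PeriodicModule

/-! ### Gorenstein projective modules and resolutions -/

namespace PeriodicModule

section GorensteinProjective

variable {R : Type u} [Ring R]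

theorem IsGorensteinProjective.congr {M N : ModuleCat.{u} R} (hM : IsGorensteinProjective M)
    (e : M ≃ₗ[R] N) : IsGorensteinProjective N := by
  obtain ⟨C, ⟨f⟩⟩ := hM
  exact ⟨C, ⟨f.trans e⟩⟩

/-- Short exact sequences `0 → L (i + 1) → P → L i → 0` with `P` projective, one for each integer
`i`, splice to a totally acyclic complex if `Ext` from each `L i` to projective modules vanishes. -/
theorem isGorensteinProjective_of_shortExact (L : ℤ → ModuleCat.{u} R)
    (hL : ∀ i, ExtVanishesAbove 0 (L i))
    (h : ∀ i, ∃ (P : ModuleCat.{u} R) (ι : L (i + 1) →ₗ[R] P) (π : P →ₗ[R] L i),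
      Module.Projective R P ∧ Function.Injective ι ∧ Function.Exact ι π ∧ Function.Surjective π) :
    IsGorensteinProjective (L 0) := by
  choose P ι π hP hι hπ hs using h
  let C : TotallyAcyclicComplex R :=
    { T := P
      d := fun i => ι i ∘ₗ π (i + 1)
      projective := hP
      exact := fun i x => by
        constructor
        · intro hx
          have h1 : π (i + 1) x = 0 := (map_eq_zero_iff (ι i) (hι i)).1 hx
          obtain ⟨y, rfl⟩ := (hπ (i + 1) x).1 h1
          obtain ⟨z, rfl⟩ := hs (i + 1 + 1) y
          exact ⟨z, rfl⟩
        · rintro ⟨z, rfl⟩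
          simp [(hπ (i + 1)).apply_apply_eq_zero]
      hom_exact := fun Q hQ i g => by
        constructor
        · intro hg
          obtain ⟨k, hk⟩ := exists_comp_eq_of_ker_le (π (i + 1)) (hs (i + 1)) g (fun x hx => by
            obtain ⟨y, rfl⟩ := (hπ (i + 1) x).1 hx
            obtain ⟨z, rfl⟩ := hs (i + 1 + 1) y
            exact LinearMap.congr_fun hg z)
          obtain ⟨f, hf⟩ := (hL i).exists_extension (hι i) (hπ i) (hs i) hQ k
          refine ⟨f, ?_⟩
          ext x
          simp [hf, hk]
        · rintro ⟨f, rfl⟩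
          ext x
          simp [(hπ (i + 1)).apply_apply_eq_zero] }
  refine ⟨C, ⟨?_⟩⟩
  have hr : LinearMap.range (C.d 0) = LinearMap.ker (π 0) := by
    rw [LinearMap.exact_iff.1 (hπ 0)]
    exact LinearMap.range_comp_of_range_eq_top _ (LinearMap.range_eq_top.2 (hs (0 + 1)))
  exact (Submodule.quotEquivOfEq _ _ hr).trans ((π 0).quotKerEquivOfSurjective (hs 0))

theorem isGorensteinProjective_of_projective {Q : ModuleCat.{u} R} (hQ : Module.Projective R Q) :
    IsGorensteinProjective Q :=
  isGorensteinProjective_of_shortExact (fun _ => Q) (fun _ => extVanishesAbove_of_projective hQ 0)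
    fun _ => ⟨ModuleCat.of R (Q × Q), LinearMap.inl R Q Q, LinearMap.snd R Q Q,
      inferInstanceAs (Module.Projective R (Q × Q)), LinearMap.inl_injective,
      Function.Exact.inl_snd, LinearMap.snd_surjective⟩

/-- The cokernels of the differentials of a totally acyclic complex are linked by short exact
sequences, so that `Ext` vanishing passes from each degree to the next. -/
theorem TotallyAcyclicComplex.extVanishesAbove_coker (C : TotallyAcyclicComplex R) (i : ℤ) :
    ExtVanishesAbove 0 (ModuleCat.of R (C.T i ⧸ LinearMap.range (C.d i))) := by
  intro Q hQ j hj
  obtain ⟨j, rfl⟩ : ∃ k, j = k + 1 := ⟨j - 1, by omega⟩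
  clear hj
  let Z : ℤ → ModuleCat.{u} R := fun i => ModuleCat.of R (C.T i ⧸ LinearMap.range (C.d i))
  let ι : ∀ i, Z (i + 1) →ₗ[R] C.T i := fun i =>
    (LinearMap.range (C.d (i + 1))).liftQ (C.d i) (LinearMap.exact_iff.1 (C.exact i)).ge
  have hι : ∀ i, Function.Injective (ι i) := fun i => by
    rw [← LinearMap.ker_eq_bot]
    exact Submodule.ker_liftQ_eq_bot _ _ _ (LinearMap.exact_iff.1 (C.exact i)).le
  let π : ∀ i, C.T i →ₗ[R] Z i := fun i => (LinearMap.range (C.d i)).mkQ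
  have hπ : ∀ i, Function.Exact (ι i) (π i) := fun i => by
    rw [LinearMap.exact_iff]
    exact (Submodule.ker_mkQ _).trans (Submodule.range_liftQ _ _ _).symm
  have hs : ∀ i, Function.Surjective (π i) := fun i => Submodule.mkQ_surjective _
  change Subsingleton (CategoryTheory.Abelian.Ext (Z i) Q (j + 1))
  induction j generalizing i with
  | zero =>
    refine subsingleton_ext_one_of_extension (hι i) (hπ i) (hs i) (C.projective i) hQ fun g => ?_
    obtain ⟨h, hh⟩ := (C.hom_exact Q hQ i (g ∘ₗ π (i + 1))).1 (by
      ext x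
      have : π (i + 1) (C.d (i + 1) x) = 0 := (Submodule.Quotient.mk_eq_zero _).2 ⟨x, rfl⟩
      simp [this])
    refine ⟨h, fun x => ?_⟩
    obtain ⟨x, rfl⟩ := hs (i + 1) x
    exact LinearMap.congr_fun hh x
  | succ j ih =>
    exact subsingleton_ext_succ (hι i) (hπ i) (hs i) (C.projective i) hQ (ih (i + 1))

theorem IsGorensteinProjective.extVanishesAbove {M : ModuleCat.{u} R}
    (hM : IsGorensteinProjective M) : ExtVanishesAbove 0 M := by
  obtain ⟨C, ⟨e⟩⟩ := hM
  exact (C.extVanishesAbove_coker 0).congr (N := ModuleCat.of R _) e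

theorem HasGorensteinProjectiveResolution.extVanishesAbove {n : ℕ} {M : ModuleCat.{u} R}
    (h : HasGorensteinProjectiveResolution n M) : ExtVanishesAbove n M := by
  induction n generalizing M with
  | zero =>
    obtain ⟨G, d, ε, hG, h0, -, hε, hs⟩ := h
    have := h0 1 one_pos
    have hinj : Function.Injective ε := by
      rw [← LinearMap.ker_eq_bot, LinearMap.ker_eq_bot']
      intro x hx
      obtain ⟨y, rfl⟩ := (hε x).1 hx
      rw [Subsingleton.elim y 0, map_zero]
    exact (hG 0 le_rfl).extVanishesAbove.congr (LinearEquiv.ofBijective ε ⟨hinj, hs⟩)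
  | succ n ih =>
    obtain ⟨G, d, ε, hG, h0, hd, hε, hs⟩ := h
    have hK : HasGorensteinProjectiveResolution n (ModuleCat.of R (LinearMap.ker ε)) := by
      refine ⟨fun i => G (i + 1), fun i => d (i + 1),
        (d 0).codRestrict _ fun x => hε.apply_apply_eq_zero x, fun i hi => hG _ (by omega),
        fun i hi => h0 _ (by omega), fun i => hd _, ?_, ?_⟩
      · intro x
        rw [← hd 0 x]
        exact Subtype.ext_iff
      · rintro ⟨x, hx⟩
        obtain ⟨y, rfl⟩ := (hε x).1 hx
        exact ⟨y, rfl⟩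
    exact (ih hK).right (ι := (LinearMap.ker ε).subtype) (π := ε)
      (LinearMap.ker ε).injective_subtype (LinearMap.exact_subtype_ker_map ε) hs
      ((hG 0 (Nat.zero_le _)).extVanishesAbove.mono (Nat.zero_le _))

theorem IsGorensteinProjective.hasResolution_zero {M : ModuleCat.{u} R}
    (hM : IsGorensteinProjective M) : HasGorensteinProjectiveResolution 0 M := by
  let G : ℕ → ModuleCat.{u} R := fun i => Nat.casesOn (motive := fun _ => ModuleCat.{u} R) i M
    fun _ => ModuleCat.of R PUnit
  have hG : ∀ i, 0 < i → Subsingleton (G i) := by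
    rintro (_ | i) hi
    · omega
    · exact inferInstanceAs (Subsingleton PUnit)
  refine ⟨G, fun i => 0, LinearMap.id, ?_, hG, fun i => ?_, ?_, Function.surjective_id⟩
  · intro i hi
    obtain rfl : i = 0 := by omega
    exact hM
  · have := hG (i + 1) (by omega)
    exact fun x => ⟨fun _ => ⟨0, Subsingleton.elim _ _⟩, fun _ => rfl⟩
  · exact fun x => ⟨fun hx => ⟨0, hx.symm⟩, fun ⟨_, hx⟩ => hx.symm⟩

/-- Splicing a resolution of `K` with `0 → K → P → M → 0` gives a resolution of `M`. -/
theorem HasGorensteinProjectiveResolution.cons {n : ℕ} {K P M : ModuleCat.{u} R}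
    {ι : K →ₗ[R] P} {π : P →ₗ[R] M} (hι : Function.Injective ι) (hπ : Function.Exact ι π)
    (hs : Function.Surjective π) (hP : IsGorensteinProjective P)
    (h : HasGorensteinProjectiveResolution n K) : HasGorensteinProjectiveResolution (n + 1) M := by
  obtain ⟨G, d, ε, hG, h0, hd, hε, hεs⟩ := h
  let G' : ℕ → ModuleCat.{u} R := fun i =>
    Nat.casesOn (motive := fun _ => ModuleCat.{u} R) i P G
  let d' : ∀ i, G' (i + 1) →ₗ[R] G' i := fun i =>
    Nat.casesOn (motive := fun i => G' (i + 1) →ₗ[R] G' i) i (ι ∘ₗ ε) d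
  refine ⟨G', d', π, ?_, ?_, ?_, ?_, hs⟩
  · rintro (_ | i) hi
    · exact hP
    · exact hG i (by omega)
  · rintro (_ | i) hi
    · omega
    · exact h0 i (by omega)
  · rintro (_ | i) x
    · exact (map_eq_zero_iff ι hι).trans (hε x)
    · exact hd i x
  · intro x
    constructor
    · intro hx
      obtain ⟨y, rfl⟩ := (hπ x).1 hx
      obtain ⟨z, rfl⟩ := hεs y
      exact ⟨z, rfl⟩
    · rintro ⟨z, rfl⟩
      exact hπ.apply_apply_eq_zero _

theorem gpd_le {n : ℕ} {M : ModuleCat.{u} R} (h : HasGorensteinProjectiveResolution n M) :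
    gpd M ≤ n :=
  iInf₂_le n h

theorem hasGorensteinProjectiveResolution_of_gpd_eq {r : ℕ} {M : ModuleCat.{u} R}
    (h : gpd M = r) : HasGorensteinProjectiveResolution r M := by
  by_contra hne
  have h1 : ((r + 1 : ℕ) : ℕ∞) ≤ gpd M ∨ ∃ m, m < r ∧ HasGorensteinProjectiveResolution m M := by
    by_contra! hc
    refine hc.1.not_ge (le_iInf₂ fun m hm => ?_)
    have : m ≠ r := fun h => hne (h ▸ hm)
    have : ¬ m < r := fun h => hc.2 m h hm
    exact_mod_cast (by omega : r + 1 ≤ m)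
  rcases h1 with h1 | ⟨m, hm, h1⟩
  · rw [h] at h1
    have : r + 1 ≤ r := by exact_mod_cast h1
    omega
  · have h2 := gpd_le h1
    rw [h] at h2
    have : r ≤ m := by exact_mod_cast h2
    omega

end GorensteinProjective

section Periodic

variable {R : Type u} [Ring R] [IsArtinianRing R]

/-- The projective covers of `M, Ω(M), …, Ωᵏ⁻¹(M)` complete `Ωᵏ(M)` to a resolution of `M`. -/
theorem gpd_le_of_nthSyzygy (M : ModuleCat.{u} R) [Module.Finite R M] (k : ℕ)
    (h : IsGorensteinProjective (nthSyzygy k M)) : gpd M ≤ k := by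
  refine gpd_le ?_
  have key : ∀ a b, a + b = k → HasGorensteinProjectiveResolution b (nthSyzygy a M) := by
    intro a b hab
    induction b generalizing a with
    | zero =>
      obtain rfl : a = k := hab
      exact h.hasResolution_zero
    | succ b ih =>
      have := finite_nthSyzygy M a
      obtain ⟨P, ι, π, -, hP, hι, hπ, hs, -⟩ := exists_syzygy_shortExact (nthSyzygy a M)
      exact (ih (a + 1) (by omega)).cons hι hπ hs (isGorensteinProjective_of_projective hP)
  exact key 0 k (zero_add k)

theorem nonempty_nthSyzygy_mul_equiv {N : ModuleCat.{u} R} [Module.Finite R N] {q : ℕ}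
    (e : nthSyzygy q N ≃ₗ[R] N) (m : ℕ) : Nonempty (nthSyzygy (m * q) N ≃ₗ[R] N) := by
  induction m with
  | zero =>
    rw [zero_mul]
    exact ⟨LinearEquiv.refl R N⟩
  | succ m ih =>
    have := finite_nthSyzygy N (m * q)
    obtain ⟨f⟩ := nthSyzygy_congr ih.some q
    rw [add_mul, one_mul, nthSyzygy_add]
    exact ⟨f.trans e⟩

/-- A periodic module is a syzygy of itself of arbitrarily high order. -/
theorem ExtVanishesAbove.of_periodic {s q : ℕ} {N : ModuleCat.{u} R} [Module.Finite R N]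
    (hN : ExtVanishesAbove s N) (hq : 0 < q) (e : PeriodicModule.nthSyzygy q N ≃ₗ[R] N) :
    ExtVanishesAbove 0 N := by
  obtain ⟨f⟩ := nonempty_nthSyzygy_mul_equiv e s
  have h := hN.nthSyzygy (s * q)
  rw [Nat.sub_eq_zero_of_le (Nat.le_mul_of_pos_right s hq)] at h
  exact h.congr f

/-- The projective covers over one period of `N` repeat to a totally acyclic complex; the projective
module `Q` enters through the split sequences `0 → Q → Q × Q → Q → 0`. -/
theorem isGorensteinProjective_of_periodic_prod {A N Q : ModuleCat.{u} R} [Module.Finite R N]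
    (hN : ExtVanishesAbove 0 N) {q : ℕ} (hq : 0 < q) (e : nthSyzygy q N ≃ₗ[R] N)
    (hQ : Module.Projective R Q) (f : A ≃ₗ[R] N × Q) : IsGorensteinProjective A := by
  let L : ℤ → ModuleCat.{u} R := fun i => nthSyzygy (i % q).toNat N
  have hL : ∀ i, ExtVanishesAbove 0 (L i) := fun i => by
    have := hN.nthSyzygy (i % q).toNat
    rwa [Nat.zero_sub] at this
  have hfin : ∀ i, Module.Finite R (L i) := fun i => finite_nthSyzygy N _
  have hLs : ∀ i, Nonempty (L (i + 1) ≃ₗ[R] syzygy (L i)) := fun i => by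
    have hq' : (0 : ℤ) < q := by exact_mod_cast hq
    have h0 := Int.emod_nonneg i hq'.ne'
    have h1 := Int.emod_lt_of_pos i hq'
    have h2 : (i + 1) % q = (i % q + 1) % q := (Int.emod_add_emod i q 1).symm
    rcases (show i % q + 1 ≤ q by omega).lt_or_eq with h3 | h3
    · have : ((i + 1) % q).toNat = (i % q).toNat + 1 := by
        rw [h2, Int.emod_eq_of_lt (by omega) h3]
        omega
      have h4 : L (i + 1) = syzygy (L i) := congrArg (nthSyzygy · N) this
      rw [h4]
      exact ⟨LinearEquiv.refl R _⟩
    · have h4 : ((i + 1) % q).toNat = 0 := by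
        rw [h2, h3, Int.emod_self]
        rfl
      have h5 : q = (i % q).toNat + 1 := by omega
      have h6 : syzygy (L i) = nthSyzygy q N := congrArg (nthSyzygy · N) h5.symm
      have h7 : L (i + 1) = N := congrArg (nthSyzygy · N) h4
      rw [h6, h7]
      exact ⟨e.symm⟩
  have hV : ∀ i, ExtVanishesAbove 0 (ModuleCat.of R (L i × Q)) := fun i =>
    ExtVanishesAbove.middle (K := Q) (M := L i) (ι := LinearMap.inr R (L i) Q)
      (π := LinearMap.fst R (L i) Q) LinearMap.inr_injective Function.Exact.inr_fst
      LinearMap.fst_surjective (extVanishesAbove_of_projective hQ 0) (hL i)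
  have h := isGorensteinProjective_of_shortExact (fun i => ModuleCat.of R (L i × Q)) hV fun i => by
    obtain ⟨P, ι, π, -, hP, hι, hπ, hs, -⟩ := exists_syzygy_shortExact (L i)
    obtain ⟨c⟩ := hLs i
    let ι' : L (i + 1) × Q →ₗ[R] P × (Q × Q) :=
      (ι ∘ₗ (c : L (i + 1) →ₗ[R] syzygy (L i))).prodMap (LinearMap.inl R Q Q)
    let π' : P × (Q × Q) →ₗ[R] L i × Q := π.prodMap (LinearMap.snd R Q Q)
    have hex : Function.Exact ι' π' := by
      rintro ⟨x, y, z⟩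
      constructor
      · intro h
        have hx : π x = 0 := congrArg Prod.fst h
        have hz : z = 0 := congrArg Prod.snd h
        obtain ⟨w, rfl⟩ := (hπ x).1 hx
        exact ⟨(c.symm w, y), by simp [ι', hz]⟩
      · rintro ⟨⟨w, y⟩, h⟩
        rw [← h]
        simp [ι', π', hπ.apply_apply_eq_zero]
    exact ⟨ModuleCat.of R (P × (Q × Q)), ι', π',
      inferInstanceAs (Module.Projective R (P × (Q × Q))),
      (hι.comp c.injective).prodMap (LinearMap.inl_injective (R := R) (M := Q) (M₂ := Q)), hex,
      hs.prodMap (LinearMap.snd_surjective (R := R) (M := Q) (M₂ := Q))⟩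
  refine h.congr (N := A) (M := ModuleCat.of R (L 0 × Q)) ?_
  have h0 : L 0 = N := by simp [L, nthSyzygy]
  rw [h0]
  exact f.symm

theorem isGorensteinProjective_of_periodic {N : ModuleCat.{u} R} [Module.Finite R N]
    (hN : ExtVanishesAbove 0 N) {q : ℕ} (hq : 0 < q) (e : nthSyzygy q N ≃ₗ[R] N) :
    IsGorensteinProjective N :=
  isGorensteinProjective_of_periodic_prod hN hq e (Q := ModuleCat.of R PUnit)
    (inferInstanceAs (Module.Projective R PUnit.{u + 1})) LinearEquiv.prodUnique.symm

end Periodic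

end PeriodicModule

/-! ### Eventually periodic modules -/

namespace PeriodicModule

section EventuallyPeriodic

variable {R : Type u} [Ring R] [IsArtinianRing R]

/-- If `Ωᵏ⁺ᵖ(M) ≅ Ωᵏ(M)` for some `k > r`, then already for `k = r + 1`: in degrees above `r`, the
syzygies have no projective summands, so that each is determined by the next. -/
theorem nonempty_nthSyzygy_equiv_of_extVanishesAbove {M : ModuleCat.{u} R} [Module.Finite R M]
    {r p : ℕ} (hV : ExtVanishesAbove r M) (j : ℕ)
    (e : nthSyzygy (r + 1 + j + p) M ≃ₗ[R] nthSyzygy (r + 1 + j) M) :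
    Nonempty (nthSyzygy (r + 1 + p) M ≃ₗ[R] nthSyzygy (r + 1) M) := by
  induction j with
  | zero => exact ⟨e⟩
  | succ j ih =>
    have hV' : ∀ k, ExtVanishesAbove 0 (nthSyzygy (r + k) M) := fun k => by
      have := hV.nthSyzygy (r + k)
      rwa [Nat.sub_eq_zero_of_le (Nat.le_add_right r k)] at this
    have hN : ∀ k, HasNoProjectiveSummand (nthSyzygy (r + k + 1) M) := fun k => by
      have := finite_nthSyzygy M (r + k)
      exact (hV' k).hasNoProjectiveSummand_syzygy
    have e' : syzygy (nthSyzygy (r + (j + p) + 1) M) ≃ₗ[R] syzygy (nthSyzygy (r + j + 1) M) := by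
      have h1 : r + 1 + (j + 1) + p = r + (j + p) + 1 + 1 := by omega
      have h2 : r + 1 + (j + 1) = r + j + 1 + 1 := by omega
      rw [h1, h2] at e
      exact e
    obtain ⟨f⟩ := (hV' (j + p + 1)).nonempty_equiv (hV' (j + 1)) (hN (j + p)) (hN j) e'
    refine ih ?_
    have h1 : r + 1 + j + p = r + (j + p) + 1 := by omega
    have h2 : r + 1 + j = r + j + 1 := by omega
    rw [h1, h2]
    exact f

end EventuallyPeriodic

end PeriodicModule

theorem corollary3p12 {R : Type u} [Ring R] [IsArtinianRing R] (M : ModuleCat.{u} R)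
    [Module.Finite R M] (n p r : ℕ) (hM : IsEventuallyPeriodic n p M) (hr : gpd M = (r : ℕ∞)) :
    ((r ≤ n ∧ n ≤ r + 1) ∧
      ∃ P : ModuleCat.{u} R, Module.Finite R P ∧ Module.Projective R P ∧
        Nonempty ((nthSyzygy (r + p) M × P) ≃ₗ[R] nthSyzygy r M)) ∧
    (n = r ↔ HasNoProjectiveSummand (nthSyzygy r M)) ∧
    (1 ≤ n → ∀ X Q : ModuleCat.{u} R, HasNoProjectiveSummand X →
      Module.Finite R Q → Module.Projective R Q →
      Nonempty (nthSyzygy (n - 1) M ≃ₗ[R] (X × Q)) →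
      (r = n - 1 ↔ Nonempty (X ≃ₗ[R] nthSyzygy (n + p - 1) M))) := by
  have hfin := finite_nthSyzygy M
  obtain ⟨⟨-, hmin⟩, ⟨hp, ⟨e⟩⟩, -⟩ := hM
  have hV : ExtVanishesAbove r M :=
    (hasGorensteinProjectiveResolution_of_gpd_eq hr).extVanishesAbove
  have hV' : ∀ k, r ≤ k → ExtVanishesAbove 0 (nthSyzygy k M) := fun k hk => by
    have := hV.nthSyzygy k
    rwa [Nat.sub_eq_zero_of_le hk] at this
  have hN : ∀ k, r < k → HasNoProjectiveSummand (nthSyzygy k M) := fun k hk => by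
    obtain ⟨k, rfl⟩ : ∃ l, k = l + 1 := ⟨k - 1, by omega⟩
    exact (hV' k (by omega)).hasNoProjectiveSummand_syzygy
  -- every syzygy from the `n`-th on is periodic
  have hper : ∀ j, Nonempty (nthSyzygy (n + j + p) M ≃ₗ[R] nthSyzygy (n + j) M) := fun j => by
    rw [← nthSyzygy_add] at e
    have := nthSyzygy_congr e j
    rwa [← nthSyzygy_add, ← nthSyzygy_add, add_right_comm] at this
  have hmin' : ∀ k, Nonempty (nthSyzygy (k + p) M ≃ₗ[R] nthSyzygy k M) → n ≤ k := fun k hk =>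
    hmin ⟨p, hp, by rwa [← nthSyzygy_add]⟩
  -- a periodic syzygy of `M` is Gorenstein projective
  have hVn : ExtVanishesAbove 0 (nthSyzygy n M) := (hV.nthSyzygy n).of_periodic hp e
  have hrn : r ≤ n := by
    have h := gpd_le_of_nthSyzygy M n (isGorensteinProjective_of_periodic hVn hp e)
    rw [hr] at h
    exact_mod_cast h
  have hr1 : Nonempty (nthSyzygy (r + 1 + p) M ≃ₗ[R] nthSyzygy (r + 1) M) := by
    refine nonempty_nthSyzygy_equiv_of_extVanishesAbove hV n ?_
    have := (hper (r + 1)).some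
    rwa [add_comm n (r + 1)] at this
  have hn1 : n ≤ r + 1 := hmin' _ hr1
  have hr1' : Nonempty (syzygy (nthSyzygy r M) ≃ₗ[R] syzygy (nthSyzygy (r + p) M)) := by
    rw [add_right_comm] at hr1
    exact ⟨hr1.some.symm⟩
  obtain ⟨P, hPf, hPp, ⟨c⟩⟩ := (hV' r le_rfl).exists_equiv_prod (hV' (r + p) (by omega))
    (hN (r + p) (by omega)) hr1'.some
  refine ⟨⟨⟨hrn, hn1⟩, P, hPf, hPp, ⟨c.symm⟩⟩, ⟨?_, ?_⟩, ?_⟩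
  · rintro rfl
    exact (hN (n + p) (by omega)).congr (hper 0).some
  · intro h
    obtain ⟨f⟩ := h.nonempty_equiv_of_prod hPp c
    exact le_antisymm (hmin' r ⟨f.symm⟩) hrn
  · intro hn X Q hX hQf hQ ⟨f⟩
    have := hX.1
    obtain ⟨m, rfl⟩ : ∃ m, n = m + 1 := ⟨n - 1, by omega⟩
    rw [Nat.add_sub_cancel] at f ⊢
    rw [show m + 1 + p - 1 = m + p by omega]
    constructor
    · rintro rfl
      have hVX : ExtVanishesAbove 0 X := (hV' r le_rfl).of_retract
        (f.symm ∘ₗ LinearMap.inl R X Q) (LinearMap.fst R X Q ∘ₗ f) (by simp)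
      obtain ⟨g⟩ := nonempty_syzygy_equiv_of_prod hQ f
      exact hVX.nonempty_equiv (hV' (r + p) (by omega)) hX (hN (r + p) (by omega))
        (g.symm.trans hr1'.some)
    · rintro ⟨g⟩
      -- `X` is a periodic syzygy of `M`, so that `Ωᵐ(M) ≅ X × Q` is Gorenstein projective
      obtain ⟨i, hi⟩ : ∃ i, m + p = m + 1 + i := ⟨p - 1, by omega⟩
      have e' : nthSyzygy p (nthSyzygy (m + p) M) ≃ₗ[R] nthSyzygy (m + p) M := by
        rw [← nthSyzygy_add, hi]
        exact (hper i).some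
      have hG := isGorensteinProjective_of_periodic_prod (hV' (m + p) (by omega)) hp e' hQ
        (f.trans (g.prodCongr (LinearEquiv.refl R Q)))
      have h := gpd_le_of_nthSyzygy M m hG
      rw [hr] at h
      have : r ≤ m := by exact_mod_cast h
      omega
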